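/- Let $K$ be a field and let $G$ be a simple graph on $[n]=\{1,\dots,n\}$ with no isolated vertices. Let $\Delta=\Delta(G)$ be its clique complex (the faces are the cliques of $G$, including $\emptyset$), and let $\Delta^\vee=\{F\subseteq[n] : [n]\setminus F\notin\Delta\}$ be its Alexander dual. Let $r\ge 3$ be an integer. Then $\Delta^\vee$ is ${\rm CM}_{n-r}$ over $K$ if and only if every cycle of $G$ of length at least $4$ and at most $r$ has a chord. Here, for a simplicial complex $\Gamma$ and $F\in\Gamma$, ${\rm link}_\Gamma F=\{E : E\cap F=\emptyset,\ E\cup F\in\Gamma\}$. The complex $\Gamma$ is Cohen–Macaulay over $K$ if $\widetilde H_i({\rm link}_\Gamma F;K)=0$ for all $F\in\Gamma$ and all $i<\dim({\rm link}_\Gamma F)$. For an integer $t$, $\Gamma$ is ${\rm CM}_t$ if it is pure (all its facets have the same number of elements) and ${\rm link}_\Gamma F$ is Cohen–Macaulay over $K$ for all $F\in\Gamma$ with $|F|\ge t$. The complex without any face (which is $\Delta^\vee$ when $G$ is complete) satisfies these conditions vacuously. -/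

import Mathlib

/-- A simplicial complex on the vertex set `V`, in the convention of combinatorial commutative
algebra: a family of finite subsets of `V` closed under passing to subsets. The empty face is a
member of every complex that has a face at all, and singletons need not be faces. So the void
complex `∅` and the complex `{∅}` are different. (Mathlib's `AbstractSimplicialComplex` excludes
the empty face and forces all singletons to be faces, so that links and Alexander duals do not
stay inside it.) -/
abbrev FinComplex (V : Type*) := LowerSet (Finset V)

namespace FinComplex

section Combinatorics

variable {V : Type*}

/-- The clique complex of a graph: its faces are the finite cliques. -/
def cliqueComplex (G : SimpleGraph V) : FinComplex V where
  carrier := {F | G.IsClique (F : Set V)}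
  lower' := fun _ _ hle h => SimpleGraph.IsClique.subset (Finset.coe_subset.2 hle) h

/-- A facet is a face that is maximal under inclusion. -/
def IsFacet (Δ : FinComplex V) (F : Finset V) : Prop := Maximal (fun E => E ∈ Δ) F

/-- A complex is pure if all its facets have the same number of elements. -/
def IsPure (Δ : FinComplex V) : Prop :=
  ∀ E F : Finset V, IsFacet Δ E → IsFacet Δ F → E.card = F.card

variable [DecidableEq V]

/-- The link of `F` in `Δ`: the sets `E` with `E ∩ F = ∅` and `E ∪ F ∈ Δ`. -/
def link (Δ : FinComplex V) (F : Finset V) : FinComplex V where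
  carrier := {E | Disjoint E F ∧ E ∪ F ∈ Δ}
  lower' := fun _ _ hle h =>
    ⟨h.1.mono_left hle, Δ.lower (Finset.union_subset_union_left hle) h.2⟩

variable [Fintype V]

/-- The Alexander dual with respect to the whole vertex set `V`: a set is a face of the dual
exactly if its complement is not a face of `Δ`. -/
def alexanderDual (Δ : FinComplex V) : FinComplex V where
  carrier := {F | Fᶜ ∉ Δ}
  lower' := fun _ _ hle h hc => h (Δ.lower (Finset.compl_subset_compl.2 hle) hc)

open Classical in
/-- The dimension of a complex that has a face: the largest `|F| - 1` over its faces `F`; thus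
`dim {∅} = -1`. (The void complex also gets `-1` here; below, `dim` is only applied to links of
faces, and these contain `∅`.) -/
noncomputable def dim (Δ : FinComplex V) : ℤ :=
  ((Finset.univ.filter (fun F : Finset V => F ∈ Δ)).sup Finset.card : ℕ) - 1

end Combinatorics

section Homology

variable (K : Type*) [Field K] {V : Type*} [Fintype V] [LinearOrder V]

/-- The simplicial boundary: for `F = {v₀ < ⋯ < vₖ}` it is
`∂ F = ∑ⱼ (-1)ʲ (F \ {vⱼ})`. In particular `∂ {v} = ∅` (augmentation) and `∂ ∅ = 0`. It is given on
all formal linear combinations `∑ c_F F` of subsets of `V`, written as coefficient functions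
`c : Finset V → K` (so that `F` itself is `Pi.single F 1`), and restricts to the chains of each
complex. -/
def boundary : (Finset V → K) →ₗ[K] (Finset V → K) :=
  Fintype.linearCombination K (fun F : Finset V =>
    ∑ v ∈ F, Pi.single (F.erase v) ((-1 : K) ^ (F.filter (fun w => w < v)).card))

/-- The `i`-chains of the augmented (reduced) chain complex of `Δ`: linear combinations of faces of
dimension `i`, that is, with `i + 1` elements. The empty face spans the `(-1)`-chains. -/
def chains (Δ : FinComplex V) (i : ℤ) : Submodule K (Finset V → K) where
  carrier := {c | ∀ F : Finset V, c F ≠ 0 → F ∈ Δ ∧ (F.card : ℤ) = i + 1}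
  zero_mem' := fun _ h => absurd rfl h
  add_mem' := fun {a b} ha hb F h => by
    by_cases h0 : a F = 0
    · exact hb F (fun h1 => h (by simp [h0, h1]))
    · exact ha F h0
  smul_mem' := fun _ _ ha F h => ha F (fun h0 => h (by simp [h0]))

/-- The reduced `i`-cycles of `Δ`. -/
def cycles (Δ : FinComplex V) (i : ℤ) : Submodule K (Finset V → K) :=
  chains K Δ i ⊓ LinearMap.ker (boundary K)

/-- The `i`-boundaries of `Δ`: the images of the `(i + 1)`-chains. -/
def boundaries (Δ : FinComplex V) (i : ℤ) : Submodule K (Finset V → K) :=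
  (chains K Δ (i + 1)).map (boundary K)

/-- The reduced simplicial homology `H̃ᵢ(Δ; K)`: cycles modulo boundaries. -/
abbrev ReducedHomology (Δ : FinComplex V) (i : ℤ) : Type _ :=
  (cycles K Δ i) ⧸ (boundaries K Δ i).submoduleOf (cycles K Δ i)

/-- `Δ` is Cohen–Macaulay over `K`: for every face `F`, the reduced homology of the link of `F`
vanishes below the dimension of that link. -/
def IsCohenMacaulay (Δ : FinComplex V) : Prop :=
  ∀ F ∈ Δ, ∀ i : ℤ, i < dim (link Δ F) → Subsingleton (ReducedHomology K (link Δ F) i)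

/-- `Δ` is `CM_t` over `K`: it is pure, and the links of all its faces with at least `t` elements
are Cohen–Macaulay. -/
def IsCM (t : ℤ) (Δ : FinComplex V) : Prop :=
  IsPure Δ ∧ ∀ F ∈ Δ, t ≤ (F.card : ℤ) → IsCohenMacaulay K (link Δ F)

end Homology

end FinComplex

/-! For a face F of Δ^∨ and W = [n] \ F, the link of F is the Alexander dual, inside W, of the
induced subcomplex Δ_W. Combinatorial Alexander duality (`cycles_le_boundaries_iff`, combined with
the acyclicity of the full simplex on W) turns vanishing of H̃_i of the link into vanishing of the
cohomology of Δ_W at faces with k = |W| - 2 - i elements.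

A set that is not a clique contains a non-edge. So the facets of Δ^∨ are complements of non-edges,
Δ^∨ is pure, and the link has dimension |W| - 3. The range i < |W| - 3 becomes k ≥ 2. Since links of
links are links (`isCM_iff`), CM_{n-r} says that Δ_W has no cohomology in degrees ≥ 1 for every
non-clique W with |W| ≤ r.

A chordless cycle of length between 4 and r violates this: on its vertex set Δ_W is a circle
(`not_cochainExactAt_of_isChordless`). If W contains no chordless cycle of length ≥ 4, Dirac's
argument (`SimpleGraph.exists_clique_separator`) splits Δ_W into two smaller induced subcomplexes
meeting in a simplex, and Mayer–Vietoris (`CochainExactAt.sup`) gives the vanishing by induction on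
W. -/

namespace FinComplex

open Finset

/-! ### Simplicial cochains: simplices, Mayer–Vietoris, relative cohomology. -/

section Cohomology

variable {K : Type*} [Field K] {V : Type*} [LinearOrder V]

/-- The incidence sign of a vertex `v` with respect to a set of vertices `F`. -/
def vertexSign (K : Type*) [Field K] (F : Finset V) (v : V) : K :=
  (-1 : K) ^ (F.filter (fun w => w < v)).card

/-- The simplicial coboundary of a function on finite sets of vertices. -/
def coboundary (f : Finset V → K) (F : Finset V) : K :=
  ∑ v ∈ F, vertexSign K F v * f (F.erase v)

/-- Exactness of the augmented simplicial cochain complex of `Δ` at the faces with `k` elements. -/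
def CochainExactAt (K : Type*) [Field K] (Δ : FinComplex V) (k : ℕ) : Prop :=
  ∀ f : Finset V → K, (∀ H ∈ Δ, H.card = k + 1 → coboundary f H = 0) →
    ∃ g : Finset V → K, ∀ H ∈ Δ, H.card = k → coboundary g H = f H

/-- Exactness of the cochain complex of the full simplex on `W` relative to `Δ` at the sets with
`k + 1` elements. -/
def RelCochainExactAt (K : Type*) [Field K] (W : Finset V) (Δ : FinComplex V) (k : ℕ) : Prop :=
  ∀ f : Finset V → K, (∀ H ∈ Δ, H.card = k + 1 → f H = 0) →
    (∀ H ⊆ W, H.card = k + 2 → coboundary f H = 0) →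
    ∃ g : Finset V → K, (∀ H ∈ Δ, H.card = k → g H = 0) ∧
      ∀ H ⊆ W, H.card = k + 1 → coboundary g H = f H

/-- The full simplex on `W`. -/
abbrev simplex (W : Finset V) : FinComplex V := LowerSet.Iic W

lemma vertexSign_mul_self (F : Finset V) (v : V) :
    vertexSign K F v * vertexSign K F v = 1 := by
  rw [vertexSign, ← mul_pow]; simp

lemma vertexSign_insert_of_lt {F : Finset V} {v w : V} (hw : w ∉ F) (h : w < v) :
    vertexSign K (insert w F) v = - vertexSign K F v := by
  rw [vertexSign, filter_insert, if_pos h, card_insert_of_notMem (by simp [hw]), pow_succ,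
    vertexSign]
  ring

lemma vertexSign_insert_of_le {F : Finset V} {v w : V} (h : v ≤ w) :
    vertexSign K (insert w F) v = vertexSign K F v := by
  rw [vertexSign, filter_insert, if_neg (not_lt.2 h), vertexSign]

lemma vertexSign_erase_of_lt {F : Finset V} {v w : V} (hw : w ∈ F) (h : w < v) :
    vertexSign K (F.erase w) v = - vertexSign K F v := by
  conv_rhs => rw [← insert_erase hw, vertexSign_insert_of_lt (notMem_erase w F) h, neg_neg]

lemma vertexSign_erase_of_le {F : Finset V} {v w : V} (hw : w ∈ F) (h : v ≤ w) :
    vertexSign K (F.erase w) v = vertexSign K F v := by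
  conv_rhs => rw [← insert_erase hw, vertexSign_insert_of_le h]

lemma vertexSign_mul_erase_swap {F : Finset V} {v w : V} (hv : v ∈ F) (hw : w ∈ F) (hne : v ≠ w) :
    vertexSign K F v * vertexSign K (F.erase v) w =
      - (vertexSign K F w * vertexSign K (F.erase w) v) := by
  rcases lt_or_gt_of_ne hne with h | h
  · rw [vertexSign_erase_of_lt hv h, vertexSign_erase_of_le hw h.le]; ring
  · rw [vertexSign_erase_of_le hv h.le, vertexSign_erase_of_lt hw h]; ring

lemma coboundary_congr {f g : Finset V → K} {F : Finset V}
    (h : ∀ v ∈ F, f (F.erase v) = g (F.erase v)) : coboundary f F = coboundary g F :=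
  sum_congr rfl fun v hv => by rw [h v hv]

lemma coboundary_eq_zero {f : Finset V → K} {F : Finset V}
    (h : ∀ v ∈ F, f (F.erase v) = 0) : coboundary f F = 0 :=
  sum_eq_zero fun v hv => by rw [h v hv, mul_zero]

lemma coboundary_sub (f g : Finset V → K) (F : Finset V) :
    coboundary (f - g) F = coboundary f F - coboundary g F := by
  simp [coboundary, mul_sub]

/-- Exchanging the order in which two vertices are removed reverses the sign, so the terms cancel in
pairs. -/
theorem coboundary_coboundary (f : Finset V → K) (F : Finset V) :
    coboundary (coboundary f) F = 0 := by
  unfold coboundary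
  simp_rw [mul_sum]
  rw [sum_sigma']
  refine sum_involution (fun x _ => ⟨x.2, x.1⟩) ?_ ?_ ?_ ?_
  · rintro ⟨v, w⟩ h
    simp only [mem_sigma, mem_erase] at h
    have h1 := vertexSign_mul_erase_swap (K := K) h.1 h.2.2 h.2.1.symm
    simp only
    rw [erase_right_comm, ← mul_assoc, ← mul_assoc, h1]
    ring
  · rintro ⟨v, w⟩ h - heq
    simp only [mem_sigma, mem_erase] at h
    exact h.2.1 (congrArg Sigma.fst heq)
  · rintro ⟨v, w⟩ h
    simp only [mem_sigma, mem_erase] at h ⊢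
    exact ⟨h.2.2, h.2.1.symm, h.1⟩
  · rintro ⟨v, w⟩ h
    rfl

/-- The cochain complex of a simplex is contractible. -/
theorem cochainExactAt_simplex (W : Finset V) {k : ℕ} (hk : 1 ≤ k) :
    CochainExactAt K (simplex W) k := by
  intro f hf
  rcases W.eq_empty_or_nonempty with rfl | hW
  · refine ⟨0, fun H hH hc => ?_⟩
    have : H = ∅ := subset_empty.1 hH
    simp [this] at hc
    omega
  set m := W.min' hW with hm
  -- Cone contraction with apex m. Taking the least vertex makes its incidence sign always 1.
  refine ⟨fun H => if m ∈ H then 0 else f (insert m H), fun H hH hc => ?_⟩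
  have hHW : H ⊆ W := hH
  have hle : ∀ w ∈ H, m ≤ w := fun w hw => W.min'_le w (hHW hw)
  have hmin : ∀ F ⊆ W, vertexSign K F m = 1 := by
    intro F hF
    rw [vertexSign, filter_eq_empty_iff.2, card_empty, pow_zero]
    exact fun w hw => not_lt.2 (W.min'_le w (hF hw))
  by_cases hmH : m ∈ H
  · unfold coboundary
    rw [sum_eq_single_of_mem m hmH]
    · simp [hmin H hHW, insert_erase hmH]
    · intro w hw hne
      simp only [if_pos (mem_erase.2 ⟨hne.symm, hmH⟩), mul_zero]
  · have hins : insert m H ⊆ W := insert_subset (W.min'_mem hW) hHW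
    have h0 := hf (insert m H) hins (by rw [card_insert_of_notMem hmH, hc])
    unfold coboundary at h0 ⊢
    rw [sum_insert hmH, hmin _ hins, one_mul, erase_insert hmH] at h0
    rw [eq_neg_of_add_eq_zero_left h0, ← sum_neg_distrib]
    refine sum_congr rfl fun w hw => ?_
    have hne : m ≠ w := fun h => hmH (h ▸ hw)
    simp only [if_neg (fun h => hmH (mem_of_mem_erase h))]
    rw [vertexSign_insert_of_lt hmH (lt_of_le_of_ne (hle w hw) hne), erase_insert_of_ne hne]
    ring

/-- Part of the Mayer–Vietoris sequence. -/
theorem CochainExactAt.sup {Δ₁ Δ₂ : FinComplex V} {k : ℕ} (h₁ : CochainExactAt K Δ₁ (k + 1))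
    (h₂ : CochainExactAt K Δ₂ (k + 1)) (h : CochainExactAt K (Δ₁ ⊓ Δ₂) k) :
    CochainExactAt K (Δ₁ ⊔ Δ₂) (k + 1) := by
  classical
  intro f hf
  obtain ⟨α, hα⟩ := h₁ f fun H hH => hf H (Or.inl hH)
  obtain ⟨β, hβ⟩ := h₂ f fun H hH => hf H (Or.inr hH)
  obtain ⟨γ, hγ⟩ := h (α - β) fun H hH hc => by
    rw [coboundary_sub, hα H hH.1 hc, hβ H hH.2 hc, sub_self]
  have hsub : ∀ {Δ : FinComplex V} {H : Finset V} (v : V), H ∈ Δ → H.erase v ∈ Δ :=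
    fun {Δ H} v hH => Δ.lower (erase_subset v H) hH
  -- Cochains are functions on all finite sets, so γ needs no extension from the intersection to Δ₁.
  refine ⟨fun H => if H ∈ Δ₁ then α H - coboundary γ H else β H, fun H hH hc => ?_⟩
  by_cases hH1 : H ∈ Δ₁
  · rw [← hα H hH1 hc, ← sub_zero (coboundary α H), ← coboundary_coboundary γ H, ← coboundary_sub]
    exact coboundary_congr fun v _ => by simp [hsub v hH1]
  · have hH2 : H ∈ Δ₂ := hH.resolve_left hH1
    rw [← hβ H hH2 hc]
    refine coboundary_congr fun v hv => ?_
    split_ifs with hv1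
    · rw [hγ _ ⟨hv1, hsub v hH2⟩ (by rw [card_erase_of_mem hv, hc]; rfl)]
      simp
    · rfl

/-- This and the next result are the connecting isomorphism of the pair (simplex, Δ), by diagram
chase: the simplex has no cohomology. -/
theorem RelCochainExactAt.cochainExactAt {W : Finset V} {Δ : FinComplex V} {k : ℕ} (hk : 1 ≤ k)
    (hΔ : Δ ≤ simplex W) (h : RelCochainExactAt K W Δ k) : CochainExactAt K Δ k := by
  intro f hf
  classical
  set φ : Finset V → K := fun H => if H ∈ Δ then f H else 0 with hφ
  obtain ⟨g, hg0, hg⟩ := h (coboundary φ)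
    (fun H hH hc => by
      rw [← hf H hH hc]
      exact coboundary_congr fun v _ => if_pos (Δ.lower (erase_subset v H) hH))
    fun H _ _ => coboundary_coboundary φ H
  obtain ⟨e, he⟩ := cochainExactAt_simplex (K := K) W hk (φ - g) fun H hH hc => by
    rw [coboundary_sub, hg H hH hc, sub_self]
  refine ⟨e, fun H hH hc => ?_⟩
  rw [he H (hΔ hH) hc, Pi.sub_apply, hg0 H hH hc, sub_zero, hφ]
  exact if_pos hH

theorem CochainExactAt.relCochainExactAt {W : Finset V} {Δ : FinComplex V} {k : ℕ}
    (hΔ : Δ ≤ simplex W) (h : CochainExactAt K Δ k) : RelCochainExactAt K W Δ k := by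
  intro f hf0 hf
  obtain ⟨g, hg⟩ := cochainExactAt_simplex (K := K) W (Nat.le_add_left 1 k) f hf
  obtain ⟨e, he⟩ := h g fun H hH hc => by rw [hg H (hΔ hH) hc, hf0 H hH hc]
  refine ⟨g - coboundary e, fun H hH hc => by rw [Pi.sub_apply, he H hH hc, sub_self],
    fun H hH hc => ?_⟩
  rw [coboundary_sub, coboundary_coboundary, sub_zero, hg H hH hc]

/-- The sign relating a set of vertices to its complement in `W`. -/
def dualSign (K : Type*) [Field K] (W H : Finset V) : K := ∏ v ∈ H, vertexSign K W v

lemma dualSign_mul_self (W H : Finset V) : dualSign K W H * dualSign K W H = 1 := by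
  rw [dualSign, ← prod_mul_distrib]
  exact prod_eq_one fun v _ => vertexSign_mul_self W v

lemma dualSign_erase {W H : Finset V} {v : V} (hv : v ∈ H) :
    dualSign K W (H.erase v) = dualSign K W H * vertexSign K W v := by
  rw [dualSign, dualSign, ← prod_erase_mul H _ hv, mul_assoc, vertexSign_mul_self, mul_one]

/-- The vertices of W below v are split between H and its complement. This is why `dualSign`
intertwines boundary and coboundary. -/
lemma vertexSign_sdiff_mul {W H : Finset V} (hH : H ⊆ W) (v : V) :
    vertexSign K (W \ H) v * vertexSign K H v = vertexSign K W v := by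
  rw [vertexSign, vertexSign, vertexSign, ← pow_add, ← card_union_of_disjoint, ← filter_union,
    sdiff_union_of_subset hH]
  exact disjoint_filter_filter sdiff_disjoint

end Cohomology

/-! ### Combinatorial Alexander duality. -/

section Duality

variable {K : Type*} [Field K] {V : Type*} [Fintype V] [LinearOrder V]

lemma boundary_apply (c : Finset V → K) (H : Finset V) :
    boundary K c H = ∑ v ∈ Hᶜ, vertexSign K H v * c (insert v H) := by
  rw [boundary, Fintype.linearCombination_apply, Finset.sum_apply]
  simp only [Pi.smul_apply, Finset.sum_apply, smul_eq_mul, mul_sum, Pi.single_apply, mul_ite,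
    mul_zero]
  rw [sum_sigma', ← sum_filter]
  refine sum_bij' (fun x _ => x.2) (fun v _ => ⟨insert v H, v⟩) ?_ ?_ ?_ ?_ ?_
  · rintro ⟨F, v⟩ h
    simp only [mem_filter, mem_sigma] at h
    simp [h.2]
  · intro v hv
    rw [mem_compl] at hv
    simp [erase_insert hv]
  · rintro ⟨F, v⟩ h
    simp only [mem_filter, mem_sigma] at h
    simp [h.2, insert_erase h.1.2]
  · intro v _
    rfl
  · rintro ⟨F, v⟩ h
    simp only [mem_filter, mem_sigma] at h
    simp only [h.2, insert_erase h.1.2]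
    rw [vertexSign_erase_of_le h.1.2 le_rfl, vertexSign, mul_comm]

/-- Up to signs, complementation turns the boundary into the coboundary. -/
theorem boundary_sdiff {W : Finset V} {c f : Finset V → K} (hc : ∀ E, c E ≠ 0 → E ⊆ W)
    {H : Finset V} (hH : H ⊆ W)
    (hf : ∀ v ∈ H, f (H.erase v) = dualSign K W (H.erase v) * c (W \ H.erase v)) :
    coboundary f H = dualSign K W H * boundary K c (W \ H) := by
  rw [boundary_apply, coboundary, mul_sum]
  have hsub : H ⊆ (W \ H)ᶜ := by
    intro v hv
    simp [hv]
  rw [← sum_subset hsub]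
  · refine sum_congr rfl fun v hv => ?_
    have : W \ H.erase v = insert v (W \ H) := by
      ext x
      by_cases hx : x = v
      · simp [hx, hH hv]
      · simp [hx]
    rw [hf v hv, dualSign_erase hv, this, ← vertexSign_sdiff_mul hH v]
    linear_combination (dualSign K W H * vertexSign K (W \ H) v * c (insert v (W \ H))) *
      vertexSign_mul_self (K := K) H v
  · intro v hv hvH
    have hvW : v ∉ W := fun h => by simp [h, hvH] at hv
    have : c (insert v (W \ H)) = 0 := by
      by_contra h0
      exact hvW (hc _ h0 (mem_insert_self _ _))
    rw [this, mul_zero, mul_zero]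

lemma mem_link_alexanderDual {Δ : FinComplex V} {F E : Finset V} :
    E ∈ link (alexanderDual Δ) F ↔ E ⊆ Fᶜ ∧ Fᶜ \ E ∉ Δ := by
  change Disjoint E F ∧ (E ∪ F)ᶜ ∉ Δ ↔ _
  rw [subset_compl_iff_disjoint_right, compl_union, sdiff_eq_inter_compl, inter_comm]

/-- Alexander duality for the links of an Alexander dual, in the form of an equivalence between
the vanishing of homology and of relative cohomology. -/
theorem cycles_le_boundaries_iff {Δ : FinComplex V} {F : Finset V} {i : ℤ} {k : ℕ}
    (hik : i + 1 + (k + 1) = (Fᶜ.card : ℤ)) :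
    cycles K (link (alexanderDual Δ) F) i ≤ boundaries K (link (alexanderDual Δ) F) i ↔
      RelCochainExactAt K Fᶜ (Δ ⊓ simplex Fᶜ) k := by
  set W := Fᶜ with hW
  have hcard : ∀ H ⊆ W, ((W \ H).card : ℤ) = W.card - H.card := fun H hH => by
    rw [card_sdiff_of_subset hH, Nat.cast_sub (card_le_card hH)]
  constructor
  · intro h f hf0 hf
    -- f transported by complementation, cut off to (i + 1)-element subsets of W to make it a chain;
    -- their complements have k + 1 elements.
    set c : Finset V → K := fun E =>
      if E ⊆ W ∧ (E.card : ℤ) = i + 1 then dualSign K W (W \ E) * f (W \ E) else 0 with hc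
    have hcW : ∀ E, c E ≠ 0 → E ⊆ W := fun E hE => by
      by_contra h0
      exact hE (if_neg fun h1 => h0 h1.1)
    have hchain : c ∈ chains K (link (alexanderDual Δ) F) i := by
      intro E hE
      have h1 : E ⊆ W ∧ (E.card : ℤ) = i + 1 := by
        by_contra h0
        exact hE (if_neg h0)
      refine ⟨mem_link_alexanderDual.2 ⟨h1.1, fun h2 => hE ?_⟩, h1.2⟩
      have h3 := hcard E h1.1
      rw [hc]
      dsimp only
      rw [if_pos h1, hf0 (W \ E) ⟨h2, sdiff_subset⟩ (by omega), mul_zero]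
    have hcyc : boundary K c = 0 := by
      ext E
      rw [Pi.zero_apply]
      by_cases hE : E ⊆ W ∧ (E.card : ℤ) = i
      · have h3 := hcard E hE.1
        have h1 := boundary_sdiff (K := K) (f := f) hcW (sdiff_subset : W \ E ⊆ W) fun v hv => by
          have h4 : (W \ E).erase v ⊆ W := (erase_subset _ _).trans sdiff_subset
          have h5 := hcard _ h4
          have h6 := card_erase_add_one hv
          rw [hc]
          dsimp only
          rw [if_pos ⟨sdiff_subset, by omega⟩, Finset.sdiff_sdiff_eq_self h4, ← mul_assoc,
            dualSign_mul_self, one_mul]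
        rw [hf _ sdiff_subset (by omega), Finset.sdiff_sdiff_eq_self hE.1] at h1
        have h2 := dualSign_mul_self (K := K) W (W \ E)
        linear_combination (- dualSign K W (W \ E)) * h1 - boundary K c E * h2
      · rw [boundary_apply]
        refine sum_eq_zero fun v hv => ?_
        rw [hc]
        dsimp only
        rw [if_neg, mul_zero]
        rintro ⟨h1, h2⟩
        rw [card_insert_of_notMem (mem_compl.1 hv)] at h2
        exact hE ⟨(subset_insert _ _).trans h1, by omega⟩
    obtain ⟨d, hd, hdc⟩ := h ⟨hchain, hcyc⟩
    refine ⟨fun H => dualSign K W H * d (W \ H), fun H hH hHc => ?_, fun H hH hHc => ?_⟩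
    · have : d (W \ H) = 0 := by
        by_contra h0
        have := (mem_link_alexanderDual.1 (hd _ h0).1).2
        rw [← hW, Finset.sdiff_sdiff_eq_self hH.2] at this
        exact this hH.1
      simp only [this, mul_zero]
    · rw [boundary_sdiff (W := W) (c := d)
        (fun E hE => (mem_link_alexanderDual.1 (hd E hE).1).1) hH fun v hv => rfl, hdc, hc]
      have h3 := hcard H hH
      dsimp only
      rw [if_pos ⟨sdiff_subset, by omega⟩, Finset.sdiff_sdiff_eq_self hH, ← mul_assoc,
        dualSign_mul_self, one_mul]
  · rintro h c ⟨hchain, hcyc⟩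
    have hcW : ∀ E, c E ≠ 0 → E ⊆ W := fun E hE => (mem_link_alexanderDual.1 (hchain E hE).1).1
    obtain ⟨g, hg0, hg⟩ := h (fun H => dualSign K W H * c (W \ H))
      (fun H hH hHc => by
        have : c (W \ H) = 0 := by
          by_contra h0
          have := (mem_link_alexanderDual.1 (hchain _ h0).1).2
          rw [← hW, Finset.sdiff_sdiff_eq_self hH.2] at this
          exact this hH.1
        simp only [this, mul_zero])
      (fun H hH hHc => by
        rw [boundary_sdiff hcW hH fun v hv => rfl, LinearMap.mem_ker.1 hcyc, Pi.zero_apply,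
          mul_zero])
    set d : Finset V → K := fun E =>
      if E ⊆ W ∧ (E.card : ℤ) = i + 1 + 1 then dualSign K W (W \ E) * g (W \ E) else 0 with hd
    have hdW : ∀ E, d E ≠ 0 → E ⊆ W ∧ (E.card : ℤ) = i + 1 + 1 := fun E hE => by
      by_contra h0
      exact hE (if_neg h0)
    refine ⟨d, fun E hE => ?_, ?_⟩
    · have h1 := hdW E hE
      refine ⟨mem_link_alexanderDual.2 ⟨h1.1, fun h2 => hE ?_⟩, h1.2⟩
      have h3 := hcard E h1.1
      rw [hd]
      dsimp only
      rw [if_pos h1, hg0 (W \ E) ⟨h2, sdiff_subset⟩ (by omega), mul_zero]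
    · ext E
      by_cases hE : E ⊆ W ∧ (E.card : ℤ) = i + 1
      · have h3 := hcard E hE.1
        have h1 := boundary_sdiff (K := K) (f := g) (fun E hE => (hdW E hE).1)
          (sdiff_subset : W \ E ⊆ W) fun v hv => by
            have h4 : (W \ E).erase v ⊆ W := (erase_subset _ _).trans sdiff_subset
            have h5 := hcard _ h4
            have h6 := card_erase_add_one hv
            rw [hd]
            dsimp only
            rw [if_pos ⟨sdiff_subset, by omega⟩, Finset.sdiff_sdiff_eq_self h4, ← mul_assoc,
              dualSign_mul_self, one_mul]
        rw [hg _ sdiff_subset (by omega), Finset.sdiff_sdiff_eq_self hE.1] at h1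
        have h2 := dualSign_mul_self (K := K) W (W \ E)
        linear_combination (- dualSign K W (W \ E)) * h1 + (c E - boundary K d E) * h2
      · have h0 : c E = 0 := by
          by_contra h0
          exact hE ⟨hcW E h0, (hchain E h0).2⟩
        rw [boundary_apply, h0]
        refine sum_eq_zero fun v hv => ?_
        rw [hd]
        dsimp only
        rw [if_neg, mul_zero]
        rintro ⟨h1, h2⟩
        rw [card_insert_of_notMem (mem_compl.1 hv)] at h2
        exact hE ⟨(subset_insert _ _).trans h1, by omega⟩

lemma subsingleton_reducedHomology_iff {Γ : FinComplex V} {i : ℤ} :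
    Subsingleton (ReducedHomology K Γ i) ↔ cycles K Γ i ≤ boundaries K Γ i := by
  rw [Submodule.Quotient.subsingleton_iff, Submodule.submoduleOf_eq_top]

/-- The reduced homology of a link of the Alexander dual of `Δ` vanishes exactly if the dual
reduced cohomology of an induced subcomplex of `Δ` does. -/
theorem subsingleton_reducedHomology_link_alexanderDual_iff {Δ : FinComplex V} {F : Finset V}
    {i : ℤ} {k : ℕ} (hk : 1 ≤ k) (hik : i + 1 + (k + 1) = (Fᶜ.card : ℤ)) :
    Subsingleton (ReducedHomology K (link (alexanderDual Δ) F) i) ↔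
      CochainExactAt K (Δ ⊓ simplex Fᶜ) k := by
  rw [subsingleton_reducedHomology_iff, cycles_le_boundaries_iff hik]
  exact ⟨fun h => h.cochainExactAt hk inf_le_right, fun h => h.relCochainExactAt inf_le_right⟩

end Duality

end FinComplex
-- Chordless cycles and clique separators.
namespace SimpleGraph

variable {V : Type*} {G : SimpleGraph V}

/-- A shortest walk with vertices in `p.support` works: a repeated vertex or a chord would give a
shortcut. -/
lemma Walk.exists_isPath_isChordless {x y : V} (p : G.Walk x y) :
    ∃ q : G.Walk x y, q.IsPath ∧ q.IsChordless ∧ q.support ⊆ p.support := by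
  classical
  have hex : ∃ n, ∃ q : G.Walk x y, q.support ⊆ p.support ∧ q.length = n :=
    ⟨_, p, List.Subset.refl _, rfl⟩
  obtain ⟨q, hqp, hqn⟩ := Nat.find_spec hex
  have hmin : ∀ q' : G.Walk x y, q'.support ⊆ p.support → q.length ≤ q'.length := fun q' hq' =>
    hqn ▸ Nat.find_min' hex ⟨q', hq', rfl⟩
  have hpath : q.IsPath := by
    rw [← q.bypass_eq_self_of_length_le_length_bypass
      (hmin _ fun z hz => hqp (q.support_bypass_subset_support hz))]
    exact q.bypass_isPath
  have key : ∀ i j, i < j → j ≤ q.length → G.Adj (q.getVert i) (q.getVert j) →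
      s(q.getVert i, q.getVert j) ∈ q.edges := by
    intro i j hij hj hadj
    have h := hmin ((q.take i).append (Walk.cons hadj (q.drop j))) (by
      intro z hz
      rw [Walk.mem_support_append_iff, Walk.support_cons, List.mem_cons] at hz
      refine hqp ?_
      rcases hz with hz | rfl | hz
      · exact (q.isSubwalk_take i).support_subset hz
      · exact q.getVert_mem_support i
      · exact (q.isSubwalk_drop j).support_subset hz)
    rw [Walk.length_append, Walk.length_cons, Walk.take_length, Walk.drop_length] at h
    obtain rfl : j = i + 1 := by omega
    rw [← Walk.mem_edges_toSubgraph]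
    exact q.toSubgraph_adj_getVert (by omega)
  refine ⟨q, hpath, Walk.isChordless_iff_forall_mem_edges.2 fun u v hu hv hadj => ?_, hqp⟩
  obtain ⟨i, rfl, hi⟩ := Walk.mem_support_iff_exists_getVert.1 hu
  obtain ⟨j, rfl, hj⟩ := Walk.mem_support_iff_exists_getVert.1 hv
  rcases lt_trichotomy i j with h | rfl | h
  · exact key i j h hj hadj
  · exact absurd hadj (G.irrefl)
  · rw [Sym2.eq_swap]
    exact key j i h hi hadj.symm

/-- Two walks between nonadjacent vertices whose interiors lie in separated sets yield a chordless
cycle. -/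
theorem exists_isCycle_isChordless {x y : V} (hne : x ≠ y) (hxy : ¬ G.Adj x y) {A B : Set V}
    (hAB : Disjoint A B) (hadj : ∀ a ∈ A, ∀ b ∈ B, ¬ G.Adj a b)
    (p : G.Walk x y) (hp : ∀ z ∈ p.support, z ∈ A ∨ z = x ∨ z = y)
    (q : G.Walk x y) (hq : ∀ z ∈ q.support, z ∈ B ∨ z = x ∨ z = y)
    (hxA : x ∉ A) (hyA : y ∉ A) (hxB : x ∉ B) (hyB : y ∉ B) :
    ∃ c : G.Walk x x, c.IsCycle ∧ 4 ≤ c.length ∧ c.IsChordless ∧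
      ∀ z ∈ c.support, z ∈ p.support ∨ z ∈ q.support := by
  have hlen : ∀ w : G.Walk x y, 2 ≤ w.length := by
    intro w
    by_contra h
    have h0 : w.length ≠ 0 := fun h0 => hne (Walk.eq_of_length_eq_zero h0)
    exact hxy (Walk.adj_of_length_eq_one (p := w) (by omega))
  obtain ⟨p', hp', hpc, hpp⟩ := p.exists_isPath_isChordless
  obtain ⟨q', hq', hqc, hqq⟩ := q.exists_isPath_isChordless
  have hpA := fun z hz => hp z (hpp hz)
  have hqB := fun z hz => hq z (hqq hz)
  have hdisj : p'.support.tail.Disjoint q'.reverse.support.tail := by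
    intro z hz hz'
    have h1 := hpA z (List.mem_of_mem_tail hz)
    have h2 := hqB z (by simpa using List.mem_of_mem_tail hz')
    have hx : z ≠ x := by
      rintro rfl
      have := hp'.support_nodup
      rw [← Walk.cons_tail_support, List.nodup_cons] at this
      exact this.1 hz
    have hy : z ≠ y := by
      rintro rfl
      have := hq'.reverse.support_nodup
      rw [← Walk.cons_tail_support, List.nodup_cons] at this
      exact this.1 hz'
    exact hAB.le_bot ⟨h1.resolve_right (by simp [hx, hy]), h2.resolve_right (by simp [hx, hy])⟩
  have h2p := hlen p'
  have h2q := hlen q'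
  have hmem : ∀ z, z ∈ (p'.append q'.reverse).support ↔ z ∈ p'.support ∨ z ∈ q'.support := by
    intro z
    rw [Walk.mem_support_append_iff, Walk.support_reverse, List.mem_reverse]
  refine ⟨p'.append q'.reverse, hp'.isCycle_append hq'.reverse hdisj (Or.inl h2p), ?_, ?_, ?_⟩
  · rw [Walk.length_append, Walk.length_reverse]
    omega
  · rw [Walk.isChordless_iff_forall_mem_edges]
    -- No edge runs from A to B, so one end is x or y and lies on both paths; chordlessness of a
    -- single path then applies.
    have main : ∀ u v, u ∈ p'.support → v ∈ q'.support → G.Adj u v →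
        s(u, v) ∈ p'.edges ∨ s(u, v) ∈ q'.edges := by
      intro u v hu hv huv
      rcases hpA u hu with hu' | hu'
      · rcases hqB v hv with hv' | hv'
        · exact absurd huv (hadj u hu' v hv')
        · refine Or.inl (hpc.mem_edges hu ?_ huv)
          rcases hv' with rfl | rfl <;> simp
      · refine Or.inr (hqc.mem_edges ?_ hv huv)
        rcases hu' with rfl | rfl <;> simp
    intro u v hu hv huv
    rw [Walk.edges_append, Walk.edges_reverse, List.mem_append, List.mem_reverse]
    rcases (hmem u).1 hu with hu | hu <;> rcases (hmem v).1 hv with hv | hv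
    · exact Or.inl (hpc.mem_edges hu hv huv)
    · exact main u v hu hv huv
    · rw [Sym2.eq_swap]
      exact main v u hv hu huv.symm
    · exact Or.inr (hqc.mem_edges hu hv huv)
  · intro z hz
    rcases (hmem z).1 hz with h | h
    · exact Or.inl (hpp h)
    · exact Or.inr (hqq h)

/-- Two vertices are joined by a walk inside `T`. -/
def JoinedIn (G : SimpleGraph V) (T : Set V) (x y : V) : Prop :=
  ∃ p : G.Walk x y, ∀ z ∈ p.support, z ∈ T

namespace JoinedIn

variable {T : Set V} {x y z : V}

lemma refl (hx : x ∈ T) : G.JoinedIn T x x := ⟨Walk.nil, by simpa using hx⟩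

lemma symm (h : G.JoinedIn T x y) : G.JoinedIn T y x := by
  obtain ⟨p, hp⟩ := h
  exact ⟨p.reverse, by simpa using hp⟩

lemma trans (h : G.JoinedIn T x y) (h' : G.JoinedIn T y z) : G.JoinedIn T x z := by
  obtain ⟨p, hp⟩ := h
  obtain ⟨q, hq⟩ := h'
  refine ⟨p.append q, fun w hw => ?_⟩
  rw [Walk.mem_support_append_iff] at hw
  exact hw.elim (hp w) (hq w)

lemma of_adj (hx : x ∈ T) (hy : y ∈ T) (h : G.Adj x y) : G.JoinedIn T x y := by
  refine ⟨Walk.cons h Walk.nil, fun z hz => ?_⟩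
  simp only [Walk.support_cons, Walk.support_nil, List.mem_cons, List.not_mem_nil, or_false] at hz
  rcases hz with rfl | rfl <;> assumption

lemma right_mem (h : G.JoinedIn T x y) : y ∈ T := by
  obtain ⟨p, hp⟩ := h
  exact hp y p.end_mem_support

lemma mono {T' : Set V} (hT : T ⊆ T') (h : G.JoinedIn T x y) : G.JoinedIn T' x y := by
  obtain ⟨p, hp⟩ := h
  exact ⟨p, fun z hz => hT (hp z hz)⟩

/-- The walk stays in the component of its first vertex. -/
lemma joinedIn_component (h : G.JoinedIn T x y) : G.JoinedIn {z | G.JoinedIn T x z} x y := by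
  classical
  obtain ⟨p, hp⟩ := h
  exact ⟨p, fun z hz => ⟨p.takeUntil z hz, fun w hw =>
    hp w (p.support_takeUntil_subset_support hz hw)⟩⟩

/-- A walk inside `T ∪ {z}` that cannot be rerouted inside `T` meets a neighbor of `z`. -/
lemma exists_adj_of_insert (h : G.JoinedIn (insert z T) x y) (hx : x ∈ T) (hy : y ∈ T)
    (hT : ¬ G.JoinedIn T x y) : ∃ w, G.JoinedIn T x w ∧ G.Adj w z := by
  obtain ⟨p, hp⟩ := h
  induction p with
  | nil => exact absurd (refl hx) hT
  | @cons u v w huv q ih =>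
    have hv := hp v (by simp)
    by_cases hvz : v = z
    · exact ⟨u, refl hx, hvz ▸ huv⟩
    · have hvT : v ∈ T := Set.mem_of_mem_insert_of_ne hv hvz
      have huv' := of_adj hx hvT huv
      obtain ⟨t, ht, htz⟩ := ih hvT hy (fun h => hT (huv'.trans h))
        fun s hs => hp s (by simp [hs])
      exact ⟨t, huv'.trans ht, htz⟩

end JoinedIn

variable [DecidableEq V]

/-- A set of vertices without chordless cycles of length at least four that is not a clique is
covered by two proper subsets that meet in a clique, with no edges between the differences. -/
theorem exists_clique_separator {W : Finset V} (hW : ¬ G.IsClique (W : Set V))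
    (hc : ∀ (v : V) (c : G.Walk v v), c.IsCycle → 4 ≤ c.length → c.IsChordless →
      ¬ ∀ z ∈ c.support, z ∈ W) :
    ∃ W₁ W₂ : Finset V, W₁ ⊂ W ∧ W₂ ⊂ W ∧ G.IsClique ((W₁ ∩ W₂ : Finset V) : Set V) ∧
      ∀ F : Finset V, G.IsClique (F : Set V) → F ⊆ W → F ⊆ W₁ ∨ F ⊆ W₂ := by
  classical
  obtain ⟨a, ha, b, hb, hab, hnadj⟩ : ∃ a ∈ W, ∃ b ∈ W, a ≠ b ∧ ¬ G.Adj a b := by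
    by_contra! h
    exact hW fun a ha b hb hab => h a ha b hb hab
  -- S separates a from b within W. An inclusion-minimal such S turns out to be a clique.
  let P : Finset V → Prop := fun S => S ⊆ W ∧ a ∉ S ∧ b ∉ S ∧
    ¬ G.JoinedIn ((W \ S : Finset V) : Set V) a b
  have hP : P (W \ {a, b}) := by
    refine ⟨Finset.sdiff_subset, by simp, by simp, ?_⟩
    rintro ⟨p, hp⟩
    cases p with
    | nil => exact hab rfl
    | @cons _ v _ huv q =>
      have := hp v (by simp)
      simp only [Finset.coe_sdiff, Set.mem_sdiff, Finset.mem_coe,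
        Finset.mem_insert, Finset.mem_singleton] at this
      have hv : v = a ∨ v = b := by tauto
      rcases hv with rfl | rfl
      · exact G.irrefl huv
      · exact hnadj huv
  obtain ⟨S, ⟨hSW, haS, hbS, hS⟩, hmin⟩ :=
    WellFounded.has_min (wellFounded_lt (α := Finset V)) {S | P S} ⟨_, hP⟩
  set T : Set V := ((W \ S : Finset V) : Set V) with hT
  have haT : a ∈ T := by simp [hT, ha, haS]
  have hbT : b ∈ T := by simp [hT, hb, hbS]
  have hTW : ∀ z ∈ T, z ∈ W ∧ z ∉ S := fun z hz => by simpa [hT] using hz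
  have hjoin : ∀ x ∈ S, G.JoinedIn (insert x T) a b := by
    intro x hx
    by_contra h
    refine hmin (S.erase x) ⟨(Finset.erase_subset _ _).trans hSW, fun h => haS
      (Finset.mem_of_mem_erase h), fun h => hbS (Finset.mem_of_mem_erase h), fun h' => h ?_⟩
      (Finset.erase_ssubset hx)
    refine h'.mono fun z hz => ?_
    simp only [Finset.coe_sdiff, Finset.coe_erase, Set.mem_sdiff, Finset.mem_coe,
      Set.mem_singleton_iff, not_and, not_not, Set.mem_insert_iff, hT] at hz ⊢
    tauto
  -- Every vertex of S has a neighbor in the component of c, so two of them are joined through it.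
  -- Used for the components of both a and b.
  have hnbr : ∀ c d, c ∈ T → d ∈ T → ¬ G.JoinedIn T c d → (∀ x ∈ S, G.JoinedIn (insert x T) c d) →
      ∀ x ∈ S, ∀ y ∈ S, ∃ p : G.Walk x y, ∀ z ∈ p.support, z ∈ {z | G.JoinedIn T c z} ∨
        z = x ∨ z = y := by
    intro c d hcT hdT hcd hj x hx y hy
    obtain ⟨u, hu, hux⟩ := (hj x hx).exists_adj_of_insert hcT hdT hcd
    obtain ⟨v, hv, hvy⟩ := (hj y hy).exists_adj_of_insert hcT hdT hcd
    obtain ⟨p, hp⟩ := hu.joinedIn_component.symm.trans hv.joinedIn_component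
    refine ⟨Walk.cons hux.symm (p.concat hvy), fun z hz => ?_⟩
    rw [Walk.support_cons, Walk.support_concat, List.mem_cons, List.mem_append, List.mem_singleton] at hz
    rcases hz with h | h | h
    · exact Or.inr (Or.inl h)
    · exact Or.inl (hp z h)
    · exact Or.inr (Or.inr h)
  have hSclique : G.IsClique (S : Set V) := by
    intro x hx y hy hxy
    by_contra hnxy
    obtain ⟨p, hp⟩ := hnbr a b haT hbT hS hjoin x hx y hy
    obtain ⟨q, hq⟩ := hnbr b a hbT haT (fun h => hS h.symm) (fun x hx => (hjoin x hx).symm) x hx y hy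
    have hnot : ∀ c, ∀ x ∈ S, x ∉ {z | G.JoinedIn T c z} := fun c x hx h =>
      (hTW x h.right_mem).2 hx
    obtain ⟨c, hcyc, hlen, hch, hsup⟩ := exists_isCycle_isChordless hxy hnxy
      (Set.disjoint_left.2 fun z hz hz' => hS (JoinedIn.trans hz (JoinedIn.symm hz')))
      (fun u hu v hv huv => hS (JoinedIn.trans hu
        ((JoinedIn.of_adj (JoinedIn.right_mem hu) (JoinedIn.right_mem hv) huv).trans (JoinedIn.symm hv))))
      p hp q hq (hnot _ x hx) (hnot _ y hy) (hnot _ x hx) (hnot _ y hy)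
    refine hc x c hcyc hlen hch fun z hz => ?_
    have hxyW : z = x ∨ z = y → z ∈ W := by rintro (rfl | rfl) <;> exact hSW ‹_›
    rcases hsup z hz with h | h
    · exact (hp z h).elim (fun h => (hTW z h.right_mem).1) hxyW
    · exact (hq z h).elim (fun h => (hTW z h.right_mem).1) hxyW
  let A : Finset V := W.filter fun z => G.JoinedIn T a z
  have hA : ∀ z, z ∈ A ↔ G.JoinedIn T a z := fun z => by
    simp only [A, Finset.mem_filter, and_iff_right_iff_imp]
    exact fun h => (hTW z h.right_mem).1
  have hAW : A ⊆ W := Finset.filter_subset _ _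
  -- A is the component of a in W \ S: the neighbors in W of its vertices lie in A ∪ S, so a clique
  -- meeting A stays there.
  refine ⟨A ∪ S, W \ A, ?_, ?_, hSclique.subset ?_, fun F hF hFW => ?_⟩
  · refine (Finset.ssubset_iff_of_subset (Finset.union_subset hAW hSW)).2 ⟨b, hb, ?_⟩
    rw [Finset.mem_union, hA]
    tauto
  · refine (Finset.ssubset_iff_of_subset Finset.sdiff_subset).2 ⟨a, ha, ?_⟩
    have : a ∈ A := (hA a).2 (JoinedIn.refl haT)
    simp [this]
  · intro z hz
    simp only [Finset.coe_inter, Finset.coe_union, Finset.coe_sdiff, Set.mem_inter_iff,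
      Set.mem_union, Set.mem_sdiff, Finset.mem_coe] at hz ⊢
    tauto
  · by_cases h : ∃ u ∈ F, u ∈ A
    · obtain ⟨u, huF, huA⟩ := h
      left
      intro v hv
      rw [Finset.mem_union]
      by_cases hvS : v ∈ S
      · exact Or.inr hvS
      · left
        by_cases huv : u = v
        · exact huv ▸ huA
        · have hvT : v ∈ T := by simp [hT, hFW hv, hvS]
          have hu := (hA u).1 huA
          exact (hA v).2 (hu.trans (JoinedIn.of_adj hu.right_mem hvT (hF huF hv huv)))
    · right
      intro v hv
      exact Finset.mem_sdiff.2 ⟨hFW hv, fun hvA => h ⟨v, hv, hvA⟩⟩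

end SimpleGraph
namespace FinComplex

open Finset

lemma cliqueComplex_inf_simplex_of_isClique {V : Type*} {G : SimpleGraph V} {W : Finset V}
    (hW : G.IsClique (W : Set V)) : cliqueComplex G ⊓ simplex W = simplex W :=
  inf_eq_right.2 fun _ hF => hW.subset (coe_subset.2 hF)

lemma link_link {V : Type*} [DecidableEq V] {Γ : FinComplex V} {F E : Finset V} (h : Disjoint E F) :
    link (link Γ F) E = link Γ (E ∪ F) := by
  ext D
  change Disjoint D E ∧ Disjoint (D ∪ E) F ∧ D ∪ E ∪ F ∈ Γ ↔ Disjoint D (E ∪ F) ∧ D ∪ (E ∪ F) ∈ Γ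
  rw [disjoint_union_left, disjoint_union_right, union_assoc]
  tauto

/-! ### Cohomology of clique complexes. -/

section CliqueComplex

variable {K : Type*} [Field K] {V : Type*} [LinearOrder V] {G : SimpleGraph V}

/-- Clique complexes of chordal graphs have no reduced cohomology in positive degrees. -/
theorem cochainExactAt_cliqueComplex (W : Finset V)
    (hc : ∀ (v : V) (c : G.Walk v v), c.IsCycle → 4 ≤ c.length → c.IsChordless →
      ¬ ∀ z ∈ c.support, z ∈ W) {k : ℕ} (hk : 2 ≤ k) :
    CochainExactAt K (cliqueComplex G ⊓ simplex W) k := by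
  induction W using Finset.strongInduction with
  | H W ih =>
    by_cases hW : G.IsClique (W : Set V)
    · rw [cliqueComplex_inf_simplex_of_isClique hW]
      exact cochainExactAt_simplex W (by omega)
    · obtain ⟨W₁, W₂, h₁, h₂, h₁₂, hF⟩ := SimpleGraph.exists_clique_separator hW hc
      have hsup : cliqueComplex G ⊓ simplex W =
          (cliqueComplex G ⊓ simplex W₁) ⊔ (cliqueComplex G ⊓ simplex W₂) := by
        refine le_antisymm (fun F hFW => ?_) (sup_le ?_ ?_)
        · exact (hF F hFW.1 hFW.2).imp (fun h => ⟨hFW.1, h⟩) (fun h => ⟨hFW.1, h⟩)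
        · exact fun F hF => ⟨hF.1, hF.2.trans h₁.subset⟩
        · exact fun F hF => ⟨hF.1, hF.2.trans h₂.subset⟩
      have hinf : (cliqueComplex G ⊓ simplex W₁) ⊓ (cliqueComplex G ⊓ simplex W₂) =
          simplex (W₁ ∩ W₂) := by
        refine le_antisymm (fun F hF => subset_inter hF.1.2 hF.2.2) fun F hF => ?_
        have hF' : F ⊆ W₁ ∩ W₂ := hF
        have hcl : F ∈ cliqueComplex G := h₁₂.subset (coe_subset.2 hF')
        exact ⟨⟨hcl, hF'.trans inter_subset_left⟩, ⟨hcl, hF'.trans inter_subset_right⟩⟩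
      obtain ⟨k, rfl⟩ : ∃ j, k = j + 1 := ⟨k - 1, by omega⟩
      rw [hsup]
      refine CochainExactAt.sup (ih W₁ h₁ ?_) (ih W₂ h₂ ?_) ?_
      · exact fun v c h h' h'' hs => hc v c h h' h'' fun z hz => h₁.subset (hs z hz)
      · exact fun v c h h' h'' hs => hc v c h h' h'' fun z hz => h₂.subset (hs z hz)
      -- Here k ≥ 2 matters: the intersection is needed one degree lower, and W₁ ∩ W₂ may be empty.
      · rw [hinf]
        exact cochainExactAt_simplex _ (by omega)

lemma coboundary_pair (g : Finset V → K) {a b : V} (hab : a ≠ b) :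
    coboundary g {a, b} = vertexSign K {a, b} a * (g {b} - g {a}) := by
  have hs : vertexSign K {a, b} b = - vertexSign K {a, b} a := by
    rcases lt_or_gt_of_ne hab with h | h
    · simp [vertexSign, filter_insert, filter_singleton, h, h.not_gt]
    · simp [vertexSign, filter_insert, filter_singleton, h, h.not_gt]
  have ha : ({a, b} : Finset V).erase a = {b} := erase_insert (by simpa using hab)
  have hb : ({a, b} : Finset V).erase b = {a} := by
    rw [pair_comm]
    exact erase_insert (by simpa using hab.symm)
  rw [coboundary, sum_pair hab, hs, ha, hb]
  ring

lemma card_support_toFinset {v : V} {c : G.Walk v v} (hc : c.IsCycle) :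
    c.support.toFinset.card = c.length := by
  have h : c.support.toFinset = c.support.tail.toFinset := by
    conv_lhs => rw [← SimpleGraph.Walk.cons_tail_support, List.toFinset_cons]
    rw [insert_eq_self, List.mem_toFinset]
    exact SimpleGraph.Walk.end_mem_tail_support hc.not_nil
  rw [h, List.toFinset_card_of_nodup hc.support_nodup, List.length_tail,
    SimpleGraph.Walk.length_support, Nat.add_sub_cancel]

/-- A chordless cycle of length at least four carries a nontrivial cohomology class. -/
theorem not_cochainExactAt_of_isChordless {v : V} {c : G.Walk v v} (hc : c.IsCycle)
    (hlen : 4 ≤ c.length) (hch : c.IsChordless) :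
    ¬ CochainExactAt K (cliqueComplex G ⊓ simplex c.support.toFinset) 2 := by
  cases c with
  | nil => simp at hlen
  | @cons _ w _ hvw p =>
    rw [SimpleGraph.Walk.cons_isCycle_iff] at hc
    rw [SimpleGraph.Walk.length_cons] at hlen
    obtain ⟨hp, he⟩ := hc
    have hedge : ∀ x y, s(x, y) ≠ s(v, w) → x ∈ (SimpleGraph.Walk.cons hvw p).support →
        y ∈ (SimpleGraph.Walk.cons hvw p).support → G.Adj x y → s(x, y) ∈ p.edges := by
      intro x y hne hx hy hxy
      have := hch.mem_edges hx hy hxy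
      rw [SimpleGraph.Walk.edges_cons, List.mem_cons] at this
      exact this.resolve_left hne
    intro hex
    -- The indicator of the first edge is a cocycle, as no triangle contains that edge: a third
    -- vertex x would be both second and penultimate on p, which has length at least 3.
    obtain ⟨g, hg⟩ := hex (fun H => if H = {v, w} then 1 else 0) fun H hH hHc => by
      refine coboundary_eq_zero fun x hx => if_neg fun hvwx => ?_
      have hvH : v ∈ H.erase x := by simp [hvwx]
      have hwH : w ∈ H.erase x := by simp [hvwx]
      rw [mem_erase] at hvH hwH
      have hmem : ∀ y ∈ H, y ∈ (SimpleGraph.Walk.cons hvw p).support := fun y hy =>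
        List.mem_toFinset.1 (hH.2 hy)
      have h1 := hp.eq_penultimate_of_mem_edges (hedge v x (by grind) (hmem v hvH.2) (hmem x hx)
        (hH.1 hvH.2 hx hvH.1))
      have h2 := hp.eq_snd_of_mem_edges (hedge w x (by grind) (hmem w hwH.2) (hmem x hx)
        (hH.1 hwH.2 hx hwH.1))
      have h3 : (1 : ℕ) = p.length - 1 := hp.getVert_injOn (by simp; omega) (by simp)
        (h2.symm.trans h1)
      omega
    have hpair : ∀ x y, s(x, y) ∈ (SimpleGraph.Walk.cons hvw p).edges →
        coboundary g {x, y} = if ({x, y} : Finset V) = {v, w} then 1 else 0 := by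
      intro x y hxy
      have hadj := SimpleGraph.Walk.adj_of_mem_edges _ hxy
      refine hg _ ⟨?_, ?_⟩ (card_pair hadj.ne)
      · change G.IsClique (({x, y} : Finset V) : Set V)
        rw [coe_pair, SimpleGraph.isClique_pair]
        exact fun _ => hadj
      · intro z hz
        rw [List.mem_toFinset]
        rcases mem_insert.1 hz with rfl | hz
        · exact SimpleGraph.Walk.fst_mem_support_of_mem_edges _ hxy
        · rw [mem_singleton.1 hz]
          exact SimpleGraph.Walk.snd_mem_support_of_mem_edges _ hxy
    -- A primitive g is constant along p, which avoids the edge {v, w} but joins its ends; so its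
    -- coboundary there is 0, not 1.
    have hconst : ∀ {a b : V} (q : G.Walk a b), q.edges ⊆ p.edges → g {a} = g {b} := by
      intro a b q
      induction q with
      | nil => exact fun _ => rfl
      | @cons a b _ hab q ih =>
        intro hq
        rw [SimpleGraph.Walk.edges_cons, List.cons_subset] at hq
        rw [← ih hq.2]
        have h0 := hpair a b (by simp [hq.1])
        rw [if_neg, coboundary_pair g hab.ne] at h0
        · have h2 := vertexSign_mul_self (K := K) {a, b} a
          linear_combination (-vertexSign K {a, b} a) * h0 + (g {b} - g {a}) * h2
        · intro h
          refine he ?_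
          have : s(v, w) = s(a, b) := by
            have hv : v ∈ ({a, b} : Finset V) := by simp [h]
            have hw : w ∈ ({a, b} : Finset V) := by simp [h]
            have := hvw.ne
            grind
          rw [this]
          exact hq.1
    have h1 := hpair v w (by simp)
    rw [if_pos rfl, coboundary_pair g hvw.ne, hconst p (List.Subset.refl _), sub_self,
      mul_zero] at h1
    exact zero_ne_one h1

end CliqueComplex

/-! ### Purity, dimension of links, and the criterion. -/

section CohenMacaulay

variable {K : Type*} [Field K] {V : Type*} [Fintype V] [LinearOrder V]

/-- The property `CM_t` in terms of the links of single faces. -/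
lemma isCM_iff {t : ℤ} {Γ : FinComplex V} :
    IsCM K t Γ ↔ IsPure Γ ∧ ∀ F ∈ Γ, t ≤ (F.card : ℤ) → ∀ i : ℤ, i < dim (link Γ F) →
      Subsingleton (ReducedHomology K (link Γ F) i) := by
  refine and_congr_right fun _ => ⟨fun h F hF ht => ?_, fun h F hF ht E hE => ?_⟩
  · have hempty : (∅ : Finset V) ∈ link Γ F := ⟨disjoint_empty_left _, by simpa using hF⟩
    have h1 := h F hF ht ∅ hempty
    rwa [link_link (disjoint_empty_left _), empty_union] at h1
  · rw [link_link hE.1]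
    refine h _ hE.2 (ht.trans ?_)
    exact_mod_cast card_le_card subset_union_right

variable {G : SimpleGraph V}

lemma exists_pair_of_mem_alexanderDual {F : Finset V}
    (hF : F ∈ alexanderDual (cliqueComplex G)) :
    ∃ a ∈ Fᶜ, ∃ b ∈ Fᶜ, a ≠ b ∧ ({a, b} : Finset V)ᶜ ∈ alexanderDual (cliqueComplex G) := by
  have h : ¬ G.IsClique ((Fᶜ : Finset V) : Set V) := hF
  by_contra! hcon
  refine h fun a ha b hb hab => ?_
  by_contra hnadj
  refine hcon a ha b hb hab fun hcl => hnadj ?_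
  rw [compl_compl] at hcl
  exact hcl (by simp) (by simp) hab

lemma isPure_alexanderDual_cliqueComplex : IsPure (alexanderDual (cliqueComplex G)) := by
  have key : ∀ F, IsFacet (alexanderDual (cliqueComplex G)) F → F.card = Fintype.card V - 2 := by
    intro F hF
    obtain ⟨a, ha, b, hb, hab, hmem⟩ := exists_pair_of_mem_alexanderDual hF.1
    have hle : F ⊆ ({a, b} : Finset V)ᶜ := by
      rw [subset_compl_comm]
      exact insert_subset ha (singleton_subset_iff.2 hb)
    rw [subset_antisymm hle (hF.2 hmem hle), card_compl, card_pair hab]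
  exact fun E F hE hF => (key E hE).trans (key F hF).symm

/-- A face of the link leaves a non-clique in Fᶜ, hence at least two vertices; leaving exactly a
non-edge attains the bound. -/
lemma dim_link_alexanderDual_cliqueComplex {F : Finset V}
    (hF : F ∈ alexanderDual (cliqueComplex G)) :
    dim (link (alexanderDual (cliqueComplex G)) F) = (Fᶜ.card : ℤ) - 3 := by
  classical
  obtain ⟨a, ha, b, hb, hab, hmem⟩ := exists_pair_of_mem_alexanderDual hF
  have hsub : ({a, b} : Finset V) ⊆ Fᶜ := insert_subset ha (singleton_subset_iff.2 hb)
  have h2 : 2 ≤ Fᶜ.card := card_pair hab ▸ card_le_card hsub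
  have hsup : ((univ.filter fun E : Finset V =>
      E ∈ link (alexanderDual (cliqueComplex G)) F).sup card) = Fᶜ.card - 2 := by
    refine le_antisymm (Finset.sup_le fun E hE => ?_) ?_
    · rw [mem_filter, mem_link_alexanderDual] at hE
      have hncl : ¬ G.IsClique ((Fᶜ \ E : Finset V) : Set V) := hE.2.2
      have h1 : 1 < (Fᶜ \ E).card := by
        by_contra hle
        refine hncl ?_
        rw [not_lt, card_le_one_iff_subsingleton] at hle
        exact hle.pairwise _
      have := card_sdiff_of_subset hE.2.1
      omega
    · have hE : Fᶜ \ {a, b} ∈ univ.filter fun E : Finset V =>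
          E ∈ link (alexanderDual (cliqueComplex G)) F := by
        rw [mem_filter, mem_link_alexanderDual, Finset.sdiff_sdiff_eq_self hsub]
        refine ⟨mem_univ _, sdiff_subset, fun h => hmem ?_⟩
        rwa [compl_compl]
      refine le_trans (le_of_eq ?_) (le_sup (f := card) hE)
      rw [card_sdiff_of_subset hsub, card_pair hab]
  rw [dim]
  convert_to ((Fᶜ.card - 2 : ℕ) : ℤ) - 1 = _
  · rw [← hsup]
  · omega

theorem isCM_alexanderDual_cliqueComplex_iff (r : ℕ) :
    IsCM K ((Fintype.card V : ℤ) - (r : ℤ)) (alexanderDual (cliqueComplex G)) ↔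
      ∀ (v : V) (c : G.Walk v v), c.IsCycle → 4 ≤ c.length → c.length ≤ r →
        ∃ e : Sym2 V, c.IsChord e := by
  rw [isCM_iff]
  constructor
  · rintro ⟨-, h⟩ v c hc h4 hr
    by_contra! hch
    have hne := not_cochainExactAt_of_isChordless (K := K) hc h4 hch
    have hcard := card_support_toFinset hc
    set W := c.support.toFinset
    refine hne ?_
    by_cases hW : G.IsClique (W : Set V)
    · rw [cliqueComplex_inf_simplex_of_isClique hW]
      exact cochainExactAt_simplex W one_le_two
    · have hF : Wᶜ ∈ alexanderDual (cliqueComplex G) := by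
        change ¬ G.IsClique ((Wᶜᶜ : Finset V) : Set V)
        rwa [compl_compl]
      have hdim := dim_link_alexanderDual_cliqueComplex hF
      have hWc := card_add_card_compl W
      -- One below the dimension |W| - 3 of the link; it is dual to k = 2, the degree of the
      -- circle's class.
      have h1 := h Wᶜ hF (by omega) ((W.card : ℤ) - 4) (by rw [hdim, compl_compl]; omega)
      rw [subsingleton_reducedHomology_link_alexanderDual_iff one_le_two
        (by rw [compl_compl]; push_cast; ring), compl_compl] at h1
      exact h1
  · refine fun h => ⟨isPure_alexanderDual_cliqueComplex, fun F hF ht i hi => ?_⟩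
    rw [dim_link_alexanderDual_cliqueComplex hF] at hi
    have hFc := card_add_card_compl F
    -- The dual index; i < |Fᶜ| - 3 gives k ≥ 2.
    obtain ⟨k, hk⟩ : ∃ k : ℕ, (k : ℤ) = Fᶜ.card - 2 - i :=
      ⟨((Fᶜ.card : ℤ) - 2 - i).toNat, Int.toNat_of_nonneg (by omega)⟩
    rw [subsingleton_reducedHomology_link_alexanderDual_iff (k := k) (by omega) (by omega)]
    refine cochainExactAt_cliqueComplex _ (fun v c hc h4 hch hsup => ?_) (by omega)
    have hle : c.length ≤ Fᶜ.card := by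
      rw [← card_support_toFinset hc]
      exact card_le_card fun z hz => hsup z (List.mem_toFinset.1 hz)
    obtain ⟨e, he⟩ := h v c hc h4 (by omega)
    exact hch he

end CohenMacaulay

end FinComplex

theorem theorem4p4 (K : Type*) [Field K] (n : ℕ) (G : SimpleGraph (Fin n))
    (hG : ∀ v : Fin n, ∃ w : Fin n, G.Adj v w) (r : ℕ) (hr : 3 ≤ r) :
    FinComplex.IsCM K ((n : ℤ) - (r : ℤ))
        (FinComplex.alexanderDual (FinComplex.cliqueComplex G)) ↔
      ∀ (v : Fin n) (c : G.Walk v v), c.IsCycle → 4 ≤ c.length → c.length ≤ r →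
        ∃ e : Sym2 (Fin n), c.IsChord e := by
  have h := FinComplex.isCM_alexanderDual_cliqueComplex_iff (K := K) (G := G) r
  rwa [Fintype.card_fin] at h
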